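/- Let $n\ge 1$ and let $L(\tau,\xi)\in\mathbb C[\tau,\xi_1,\dots,\xi_n]$ be a polynomial of (total) degree $m$ that is strictly hyperbolic: for every $\xi\in\mathbb R^n\setminus\{0\}$ its $m$-homogeneous part $L_m(\tau,\xi)$, seen as a polynomial in $\tau$, has exactly $m$ distinct complex roots, and all of them are real. Then the roots of $L_m(\cdot,\eta)$, $\eta\in\mathbb S^{n-1}$, can be enumerated by continuous functions $\phi_1,\dots,\phi_m:\mathbb S^{n-1}\to\mathbb R$. For every such continuous enumeration the functions $\phi_j$ are smooth, and there are an enumeration $\tau_1(\xi),\dots,\tau_m(\xi)$, for each $\xi\in\mathbb R^n$, of the roots of $L(\cdot,\xi)$ in $\mathbb C$ (counted with multiplicity; the characteristic roots) and smooth algebraic functions $\tau_j^{(k)}:\mathbb S^{n-1}\to\mathbb C$ $(1\le j\le m,\ k\ge 0)$ such that $$\tau_j(\xi)\sim|\xi|\,\phi_j(\eta)+\tau_j^{(0)}(\eta)+|\xi|^{-1}\tau_j^{(1)}(\eta)+\cdots,\qquad |\xi|\to\infty,$$ uniformly in $\eta=\xi/|\xi|\in\mathbb S^{n-1}$; that is,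 for every $j$ and every $N\ge 0$ there are $C$ and $R>0$ such that for all $\xi\in\mathbb R^n$ with $|\xi|\ge R$, with $\eta=\xi/|\xi|$, $$\Bigl|\tau_j(\xi)-|\xi|\,\phi_j(\eta)-\sum_{k=0}^{N-1}|\xi|^{-k}\tau_j^{(k)}(\eta)\Bigr|\le C\,|\xi|^{-N}.$$ Here $f:\mathbb S^{n-1}\to\mathbb C$ is called algebraic if there is a polynomial $P(\eta,T)\in\mathbb C[\eta_1,\dots,\eta_n,T]$ such that for every $\eta\in\mathbb S^{n-1}$ the polynomial $P(\eta,\cdot)$ is not identically zero and $P(\eta,f(\eta))=0$. -/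

import Mathlib

open scoped Manifold ContDiff

noncomputable section

/-- A polynomial `L(τ, ξ)` in `1 + n` variables with complex coefficients, the variable `τ` being
indexed by `none` and `ξ₁, …, ξₙ` by `some i`, seen as a polynomial in `τ` for fixed `ξ ∈ ℝⁿ`. -/
def polyInTau {n : ℕ} (L : MvPolynomial (Option (Fin n)) ℂ) (ξ : EuclideanSpace ℝ (Fin n)) :
    Polynomial ℂ :=
  MvPolynomial.aeval
    (fun o : Option (Fin n) => o.elim Polynomial.X (fun i => Polynomial.C ((ξ i : ℝ) : ℂ))) L

/-- The principal part: the homogeneous part `L_m` of `L`, where `m` is the degree of `L`. -/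
def principalPart {n : ℕ} (L : MvPolynomial (Option (Fin n)) ℂ) :
    MvPolynomial (Option (Fin n)) ℂ :=
  MvPolynomial.homogeneousComponent L.totalDegree L

/-- `r` lists `m = deg L` distinct real numbers which are precisely the complex roots of
`τ ↦ L_m(τ, ξ)`. (In particular this polynomial in `τ` does not vanish identically.) -/
def IsPrincipalRootList {n : ℕ} (L : MvPolynomial (Option (Fin n)) ℂ)
    (ξ : EuclideanSpace ℝ (Fin n)) (r : Fin L.totalDegree → ℝ) : Prop :=
  Function.Injective r ∧
    ∀ z : ℂ, (polyInTau (principalPart L) ξ).eval z = 0 ↔ ∃ j, z = ((r j : ℝ) : ℂ)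

/-- Strict hyperbolicity: for every real `ξ ≠ 0` the principal part `L_m(τ, ξ)` has, as a
polynomial in `τ`, `m` distinct real roots. -/
def IsStrictlyHyperbolic {n : ℕ} (L : MvPolynomial (Option (Fin n)) ℂ) : Prop :=
  ∀ ξ : EuclideanSpace ℝ (Fin n), ξ ≠ 0 → ∃ r, IsPrincipalRootList L ξ r

/-- The unit sphere of `ℝⁿ`. -/
abbrev USphere (n : ℕ) : Type := Metric.sphere (0 : EuclideanSpace ℝ (Fin n)) 1

/-- A continuous enumeration `φ₁, …, φ_m` of the roots of the principal part over the sphere. -/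
def IsPrincipalRootFamily {n : ℕ} (L : MvPolynomial (Option (Fin n)) ℂ)
    (φ : Fin L.totalDegree → USphere n → ℝ) : Prop :=
  (∀ j, Continuous (φ j)) ∧
    ∀ η : USphere n, IsPrincipalRootList L (η : EuclideanSpace ℝ (Fin n)) (fun j => φ j η)

/-- `τ₁(ξ), …, τ_m(ξ)` are, for every `ξ ∈ ℝⁿ`, the roots of `L(·, ξ)` in `ℂ`, counted with
multiplicity. -/
def IsCharacteristicRootFamily {n : ℕ} (L : MvPolynomial (Option (Fin n)) ℂ)
    (τ : Fin L.totalDegree → EuclideanSpace ℝ (Fin n) → ℂ) : Prop :=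
  ∀ ξ, (polyInTau L ξ).roots = (Finset.univ : Finset (Fin L.totalDegree)).val.map (fun j => τ j ξ)

/-- `f : S^{n-1} → ℂ` is algebraic: there is a polynomial `P(η, T)` such that, for every `η` in the
sphere, `P(η, ·)` is not the zero polynomial and `P(η, f(η)) = 0`. -/
def IsAlgebraicOnSphere {n : ℕ} (f : USphere n → ℂ) : Prop :=
  ∃ P : Polynomial (MvPolynomial (Fin n) ℂ), ∀ η : USphere n,
    P.map (MvPolynomial.eval
        (fun i => (((η : EuclideanSpace ℝ (Fin n)) i : ℝ) : ℂ))) ≠ 0 ∧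
      (P.map (MvPolynomial.eval
        (fun i => (((η : EuclideanSpace ℝ (Fin n)) i : ℝ) : ℂ)))).eval (f η) = 0

/-- The full asymptotic expansion
`τ(ξ) ∼ |ξ| φ(η) + t₀(η) + |ξ|⁻¹ t₁(η) + |ξ|⁻² t₂(η) + ⋯` as `|ξ| → ∞`, where `ξ = |ξ| η`,
uniformly in `η` in the sphere. -/
def HasUniformExpansion {n : ℕ} (τ : EuclideanSpace ℝ (Fin n) → ℂ) (φ : USphere n → ℝ)
    (t : ℕ → USphere n → ℂ) : Prop :=
  ∀ N : ℕ, ∃ C R : ℝ, 0 < R ∧ ∀ ρ : ℝ, R ≤ ρ → ∀ η : USphere n,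
    ‖τ (ρ • (η : EuclideanSpace ℝ (Fin n))) -
        ((ρ : ℂ) * ((φ η : ℝ) : ℂ) + ∑ k ∈ Finset.range N, ((ρ : ℂ) ^ k)⁻¹ * t k η)‖
      ≤ C * (ρ ^ N)⁻¹

end

/-!
Write `m = deg L`. In the variables `z = τ / ρ`, `ε = 1 / ρ`, where `ξ = ρ η` with `|η| = 1`, the
equation `L(τ, ξ) = 0` becomes `F(z, ε, η) = 0` with `F = ∑ ε ^ (m - k) L_k(z, η)`
(`rescaledSymbol`). At `ε = 0` this is the principal part, whose roots `φ j η` are simple. The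
expansion of the characteristic roots is the expansion in powers of `ε` of the roots of `F`.

*The coefficients.* All of them live in one ring `smoothAlgFun` of functions on the sphere: the
smooth functions `f` such that `D f` is integral over the polynomial functions for some polynomial
`D` without zeros on the sphere. Integrality makes this a ring, and each member is algebraic
(`isAlgebraicOnSphere_of_mem`). It contains the `φ j`, and it also contains the inverse of
`∂L_m/∂τ` at `φ j`, because the resultant of `L_m` and `∂L_m/∂τ` is a polynomial in `η` that does
not vanish on the sphere (`IsPrincipalRootFamily.exists_mul_derivative_eq_one`). Hensel's lemma
over this ring, with respect to `ε` (`Polynomial.exists_formal_root`), then lifts `φ j` to a formal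
power series root of `F`; its coefficients are smooth and algebraic.

*The remainder.* If `S` is the truncation of the formal root after `ε ^ N`, then
`F(S, ε, η) = O(ε ^ (N + 1))`, uniformly on the sphere by compactness. By compactness again, the
principal roots are uniformly separated. Since a polynomial over `ℂ` is the product of its linear
factors, smallness of `F(φ j, ε, η)` forces a root close to each `φ j`
(`Polynomial.exists_roots_near`), which labels the characteristic roots for large `ρ`; then
smallness of `F(S, ε, η)` bounds the distance of `S` to the root with that label
(`Polynomial.norm_sub_root_mul_le`).

*The principal roots.* A continuous simple root agrees locally with the function given by the
implicit function theorem, so it is smooth. The roots are real, so they can be listed in increasing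
order, and the implicit function theorem shows that this list is continuous.
-/

open scoped Topology

/-! ### Roots of polynomials and a formal Hensel lemma -/

open Polynomial in
theorem Polynomial.roots_eq_map_of_injective {K : Type*} [Field K] {m : ℕ} {p : K[X]} (hp : p ≠ 0)
    (hdeg : p.natDegree ≤ m) {z : Fin m → K} (hinj : Function.Injective z)
    (hroot : ∀ j, p.eval (z j) = 0) :
    p.roots = (Finset.univ : Finset (Fin m)).val.map z := by
  symm
  apply Multiset.eq_of_le_of_card_le
  · rw [Multiset.le_iff_subset (Multiset.Nodup.map hinj Finset.univ.nodup)]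
    intro x hx
    obtain ⟨j, -, rfl⟩ := Multiset.mem_map.1 hx
    exact (mem_roots hp).2 (hroot j)
  · simpa using (card_roots' p).trans hdeg

open Polynomial in
theorem Polynomial.norm_eval_eq_of_roots_eq_map {m : ℕ} {p : ℂ[X]} {z : Fin m → ℂ}
    (h : p.roots = (Finset.univ : Finset (Fin m)).val.map z) (s : ℂ) :
    ‖p.eval s‖ = ‖p.leadingCoeff‖ * ∏ i, ‖s - z i‖ := by
  have := IsAlgClosed.splits p
  rw [this.eval_eq_prod_roots, h, norm_mul, Multiset.map_map]
  congr 1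
  rw [show (Multiset.map ((fun x => s - x) ∘ z) Finset.univ.val).prod = ∏ i, (s - z i) from rfl,
    norm_prod]

open Polynomial in
theorem Polynomial.exists_roots_eq_map {m : ℕ} {p : ℂ[X]} (hdeg : p.natDegree = m) :
    ∃ z : Fin m → ℂ, p.roots = (Finset.univ : Finset (Fin m)).val.map z := by
  have hc : p.roots.card = m := by
    rw [← hdeg]; exact (IsAlgClosed.splits p).natDegree_eq_card_roots.symm
  subst hc
  refine ⟨fun i => p.roots.toList.get (i.cast (by simp)), ?_⟩
  conv_lhs => rw [← Multiset.coe_toList p.roots]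
  rw [Fin.univ_val_map, Multiset.coe_eq_coe]
  apply List.Perm.of_eq
  apply List.ext_get <;> simp

open Polynomial in
/-- A polynomial that is small at well separated points has a root close to each of them. -/
theorem Polynomial.exists_roots_near {m : ℕ} {p : ℂ[X]} (hdeg : p.natDegree = m) (hp : p ≠ 0)
    {w : Fin m → ℂ} {δ : ℝ} (hw : ∀ i j, i ≠ j → δ ≤ ‖w i - w j‖) (hδ : 0 < δ)
    (hsmall : ∀ j, ‖p.eval (w j)‖ < ‖p.leadingCoeff‖ * (δ / 4) ^ m) :
    ∃ z : Fin m → ℂ, p.roots = (Finset.univ : Finset (Fin m)).val.map z ∧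
      ∀ j, ‖z j - w j‖ < δ / 4 := by
  obtain ⟨y, hy⟩ := exists_roots_eq_map hdeg
  have key : ∀ j, ∃ i, ‖w j - y i‖ < δ / 4 := by
    intro j
    by_contra! hfar
    refine absurd (hsmall j) (not_lt.2 ?_)
    rw [norm_eval_eq_of_roots_eq_map hy]
    gcongr
    calc (δ / 4) ^ m = ∏ _i : Fin m, (δ / 4) := by
          rw [Finset.prod_const, Finset.card_univ, Fintype.card_fin]
      _ ≤ _ := Finset.prod_le_prod (fun _ _ => by positivity) (fun i _ => hfar i)
  -- The roots found are distinct, since the points are `δ`-separated, and so they are all.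
  choose σ hσ using key
  refine ⟨fun j => y (σ j), roots_eq_map_of_injective hp hdeg.le ?_ ?_, fun j => ?_⟩
  · intro i j hij
    by_contra hne
    have h1 := hw i j hne
    have h2 : ‖w i - w j‖ ≤ ‖w i - y (σ i)‖ + ‖w j - y (σ j)‖ := by
      calc ‖w i - w j‖ = ‖(w i - y (σ i)) - (w j - y (σ j))‖ := by
            congr 1; simp only at hij; rw [hij]; ring
        _ ≤ _ := norm_sub_le _ _
    linarith [hσ i, hσ j]
  · intro j
    have : y (σ j) ∈ p.roots := by rw [hy]; exact Multiset.mem_map_of_mem _ (Finset.mem_univ_val _)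
    exact (mem_roots hp).1 this
  · rw [norm_sub_rev]; exact hσ j

open Polynomial in
/-- Near one of several separated roots, the distance to that root is controlled by the value of
the polynomial, because the remaining linear factors are bounded below. -/
theorem Polynomial.norm_sub_root_mul_le {m : ℕ} {p : ℂ[X]} {z w : Fin m → ℂ} {δ : ℝ} (hδ : 0 < δ)
    (hroots : p.roots = (Finset.univ : Finset (Fin m)).val.map z)
    (hw : ∀ i j, i ≠ j → δ ≤ ‖w i - w j‖) (hz : ∀ j, ‖z j - w j‖ < δ / 4)
    (j : Fin m) {s : ℂ} (hs : ‖s - w j‖ ≤ δ / 4) :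
    ‖s - z j‖ * (‖p.leadingCoeff‖ * (δ / 2) ^ (m - 1)) ≤ ‖p.eval s‖ := by
  classical
  rw [norm_eval_eq_of_roots_eq_map hroots, ← Finset.mul_prod_erase _ _ (Finset.mem_univ j)]
  have : (δ / 2) ^ (m - 1) ≤ ∏ i ∈ Finset.univ.erase j, ‖s - z i‖ := by
    calc (δ / 2) ^ (m - 1) = ∏ _i ∈ Finset.univ.erase j, (δ / 2) := by
          rw [Finset.prod_const, Finset.card_erase_of_mem (Finset.mem_univ j), Finset.card_univ,
            Fintype.card_fin]
      _ ≤ _ := by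
        refine Finset.prod_le_prod (fun _ _ => by positivity) (fun i hi => ?_)
        have h1 := hw j i (Finset.ne_of_mem_erase hi).symm
        have h2 : ‖w j - w i‖ ≤ ‖s - z i‖ + ‖s - w j‖ + ‖z i - w i‖ := by
          calc ‖w j - w i‖ = ‖(s - z i) - (s - w j) + (z i - w i)‖ := by congr 1; ring
            _ ≤ _ := (norm_add_le _ _).trans (by gcongr; exact norm_sub_le _ _)
        linarith [hz i]
  calc _ = ‖p.leadingCoeff‖ * (‖s - z j‖ * (δ / 2) ^ (m - 1)) := by ring
    _ ≤ _ := by gcongr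

open Polynomial in
/-- Hensel's lemma with respect to the ideal `(X)`, in terms of truncations: a root `a` of
`F mod X` at which the derivative is invertible lifts to a formal power series root of `F`. -/
theorem Polynomial.exists_formal_root {A : Type*} [CommRing A] (F : A[X][X]) (a u : A)
    (h0 : (F.map (evalRingHom 0)).eval a = 0)
    (h1 : u * (F.map (evalRingHom 0)).derivative.eval a = 1) :
    ∃ s : ℕ → A, s 0 = a ∧
      ∀ N, X ^ (N + 1) ∣ F.eval (∑ k ∈ Finset.range (N + 1), C (s k) * X ^ k) := by
  -- Newton's iteration, with the constant factor `u` in place of `1 / F'(S)`; the step from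
  -- `S N` to `S (N + 1)` cancels the coefficient of `X ^ (N + 1)` in `F(S N)`.
  let S : ℕ → A[X] := fun N => Nat.rec (C a)
    (fun k P => P + C (-u * (F.eval P).coeff (k + 1)) * X ^ (k + 1)) N
  have hS0 : S 0 = C a := rfl
  have hSs : ∀ k, S (k + 1) = S k + C (-u * (F.eval (S k)).coeff (k + 1)) * X ^ (k + 1) :=
    fun _ => rfl
  let s : ℕ → A := fun N => Nat.casesOn N a (fun k => -u * (F.eval (S k)).coeff (k + 1))
  have hsum : ∀ N, ∑ k ∈ Finset.range (N + 1), C (s k) * X ^ k = S N := by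
    intro N
    induction N with
    | zero => simp [s, hS0]
    | succ N ih => rw [Finset.sum_range_succ, ih, hSs]
  have hconst : ∀ N, (S N).eval 0 = a := by
    intro N
    induction N with
    | zero => simp [hS0]
    | succ N ih => rw [hSs]; simp [ih]
  have hev : ∀ (G : A[X][X]) (P : A[X]),
      (G.eval P).eval 0 = (G.map (evalRingHom 0)).eval (P.eval 0) := by
    intro G P
    rw [eval_map, ← coe_evalRingHom, eval, hom_eval₂, RingHom.comp_id]
  refine ⟨s, rfl, fun N => ?_⟩
  rw [hsum]
  induction N with
  | zero =>
    rw [zero_add, pow_one, X_dvd_iff, coeff_zero_eq_eval_zero, hev, hconst, h0]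
  | succ N ih =>
    obtain ⟨G, hG⟩ := ih
    have hcoeff : (F.eval (S N)).coeff (N + 1) = G.eval 0 := by
      rw [hG, ← coeff_zero_eq_eval_zero]; simpa using coeff_X_pow_mul G (N + 1) 0
    rw [hSs, hcoeff]
    obtain ⟨K, hK⟩ := F.binomExpansion (S N) (C (-u * G.eval 0) * X ^ (N + 1))
    rw [hK, hG, show X ^ (N + 1) * G + F.derivative.eval (S N) * (C (-u * G.eval 0) * X ^ (N + 1)) +
      K * (C (-u * G.eval 0) * X ^ (N + 1)) ^ 2 = X ^ (N + 1) * (G +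
        F.derivative.eval (S N) * C (-u * G.eval 0) +
        K * C (-u * G.eval 0) ^ 2 * X ^ (N + 1)) by ring, pow_succ _ (N + 1)]
    refine mul_dvd_mul_left _ ?_
    rw [X_dvd_iff, coeff_zero_eq_eval_zero]
    simp only [eval_add, eval_mul, eval_C, eval_pow, eval_X, hev, hconst, ← derivative_map]
    linear_combination (-(G.eval 0)) * h1

/-! ### The polynomial in `τ` -/

/-- Evaluation of polynomials in `ξ` at a real point. -/
abbrev realEval {n : ℕ} (ξ : EuclideanSpace ℝ (Fin n)) : MvPolynomial (Fin n) ℂ →+* ℂ :=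
  MvPolynomial.eval (fun i => ((ξ i : ℝ) : ℂ))

theorem polyInTau_eq_map {n : ℕ} (L : MvPolynomial (Option (Fin n)) ℂ)
    (ξ : EuclideanSpace ℝ (Fin n)) :
    polyInTau L ξ = (MvPolynomial.optionEquivLeft ℂ (Fin n) L).map (realEval ξ) := by
  have : (MvPolynomial.aeval (R := ℂ) (fun o : Option (Fin n) =>
        o.elim Polynomial.X (fun i => Polynomial.C ((ξ i : ℝ) : ℂ)))).toRingHom =
      (Polynomial.mapRingHom (realEval ξ)).comp
        (MvPolynomial.optionEquivLeft ℂ (Fin n)).toRingEquiv.toRingHom := by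
    apply MvPolynomial.ringHom_ext
    · intro r; simp
    · rintro (_ | i) <;> simp
  exact congrArg (fun f => f L) this

theorem eval_polyInTau {n : ℕ} (L : MvPolynomial (Option (Fin n)) ℂ)
    (ξ : EuclideanSpace ℝ (Fin n)) (z : ℂ) :
    (polyInTau L ξ).eval z =
      MvPolynomial.eval (fun o => o.elim z (fun i => ((ξ i : ℝ) : ℂ))) L := by
  rw [polyInTau_eq_map, MvPolynomial.optionEquivLeft_elim_eval]

theorem natDegree_optionEquivLeft_le_of_totalDegree_le {n m : ℕ}
    {p : MvPolynomial (Option (Fin n)) ℂ} (h : p.totalDegree ≤ m) :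
    (MvPolynomial.optionEquivLeft ℂ (Fin n) p).natDegree ≤ m := by
  rw [MvPolynomial.natDegree_optionEquivLeft]
  exact (MvPolynomial.degreeOf_le_totalDegree p none).trans h

/-- The coefficient of `τ ^ m` in a polynomial of total degree at most `m` does not depend on
`ξ`. -/
theorem coeff_optionEquivLeft_of_totalDegree_le {n m : ℕ}
    {p : MvPolynomial (Option (Fin n)) ℂ} (h : p.totalDegree ≤ m) :
    (MvPolynomial.optionEquivLeft ℂ (Fin n) p).coeff m =
      MvPolynomial.C (p.coeff (Finsupp.single none m)) := by
  ext d
  rw [MvPolynomial.optionEquivLeft_coeff_coeff, MvPolynomial.coeff_C]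
  split_ifs with hd
  · subst hd
    congr 1
  · refine MvPolynomial.coeff_eq_zero_of_totalDegree_lt ?_
    obtain ⟨i, hi⟩ : ∃ i, d i ≠ 0 := by
      by_contra! hall
      exact hd (by ext i; simp [hall i])
    refine h.trans_lt ?_
    have : (d.optionElim m).degree = m + d.degree := by
      rw [Finsupp.degree_eq_sum, Finsupp.degree_eq_sum, Fintype.sum_option]
      simp
    change _ < (d.optionElim m).degree
    rw [this]
    have h2 : d i ≤ d.degree := Finsupp.le_degree i d
    omega

theorem natDegree_polyInTau_le {n m : ℕ} {p : MvPolynomial (Option (Fin n)) ℂ}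
    (h : p.totalDegree ≤ m) (ξ : EuclideanSpace ℝ (Fin n)) : (polyInTau p ξ).natDegree ≤ m := by
  rw [polyInTau_eq_map]
  exact Polynomial.natDegree_map_le.trans (natDegree_optionEquivLeft_le_of_totalDegree_le h)

theorem coeff_polyInTau {n m : ℕ} {p : MvPolynomial (Option (Fin n)) ℂ}
    (h : p.totalDegree ≤ m) (ξ : EuclideanSpace ℝ (Fin n)) :
    (polyInTau p ξ).coeff m = p.coeff (Finsupp.single none m) := by
  rw [polyInTau_eq_map, Polynomial.coeff_map, coeff_optionEquivLeft_of_totalDegree_le h]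
  simp

theorem totalDegree_principalPart_le {n : ℕ} (L : MvPolynomial (Option (Fin n)) ℂ) :
    (principalPart L).totalDegree ≤ L.totalDegree :=
  (MvPolynomial.homogeneousComponent_isHomogeneous _ _).totalDegree_le

/-- The coefficient of `τ ^ m` in `L`, where `m = deg L`. -/
noncomputable def tauLeadingCoeff {n : ℕ} (L : MvPolynomial (Option (Fin n)) ℂ) : ℂ :=
  L.coeff (Finsupp.single none L.totalDegree)

theorem coeff_principalPart {n : ℕ} (L : MvPolynomial (Option (Fin n)) ℂ) :
    (principalPart L).coeff (Finsupp.single none L.totalDegree) = tauLeadingCoeff L := by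
  rw [principalPart, MvPolynomial.coeff_homogeneousComponent, if_pos (by simp), tauLeadingCoeff]

section PrincipalRoots

variable {n : ℕ} {L : MvPolynomial (Option (Fin n)) ℂ} {ξ : EuclideanSpace ℝ (Fin n)}
  {r : Fin L.totalDegree → ℝ}

namespace IsPrincipalRootList

theorem eval_eq_zero (h : IsPrincipalRootList L ξ r) (j : Fin L.totalDegree) :
    (polyInTau (principalPart L) ξ).eval (r j : ℂ) = 0 :=
  (h.2 _).2 ⟨j, rfl⟩

theorem polyInTau_ne_zero (h : IsPrincipalRootList L ξ r) : polyInTau (principalPart L) ξ ≠ 0 := by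
  intro h0
  have hfin : (Set.range (fun j => (r j : ℂ))).Finite := Set.finite_range _
  obtain ⟨z, hz⟩ := hfin.infinite_compl.nonempty
  obtain ⟨j, hj⟩ := (h.2 z).1 (by rw [h0, Polynomial.eval_zero])
  exact hz ⟨j, hj.symm⟩

theorem roots_eq (h : IsPrincipalRootList L ξ r) :
    (polyInTau (principalPart L) ξ).roots =
      (Finset.univ : Finset (Fin L.totalDegree)).val.map (fun j => (r j : ℂ)) :=
  Polynomial.roots_eq_map_of_injective h.polyInTau_ne_zero
    (natDegree_polyInTau_le (totalDegree_principalPart_le L) ξ)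
    (Complex.ofReal_injective.comp h.1) h.eval_eq_zero

theorem natDegree_eq (h : IsPrincipalRootList L ξ r) :
    (polyInTau (principalPart L) ξ).natDegree = L.totalDegree := by
  rw [(IsAlgClosed.splits _).natDegree_eq_card_roots, h.roots_eq]; simp

theorem tauLeadingCoeff_ne_zero (h : IsPrincipalRootList L ξ r) : tauLeadingCoeff L ≠ 0 := by
  have := Polynomial.leadingCoeff_ne_zero.2 h.polyInTau_ne_zero
  rwa [Polynomial.leadingCoeff, h.natDegree_eq, coeff_polyInTau (totalDegree_principalPart_le L),
    coeff_principalPart] at this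

theorem separable (h : IsPrincipalRootList L ξ r) :
    (polyInTau (principalPart L) ξ).Separable := by
  rw [← Polynomial.nodup_roots_iff_of_splits h.polyInTau_ne_zero (IsAlgClosed.splits _), h.roots_eq]
  exact Multiset.Nodup.map (Complex.ofReal_injective.comp h.1) Finset.univ.nodup

theorem eval_derivative_ne_zero (h : IsPrincipalRootList L ξ r) (j : Fin L.totalDegree) :
    (polyInTau (principalPart L) ξ).derivative.eval (r j : ℂ) ≠ 0 := by
  have := h.separable.eval₂_derivative_ne_zero (RingHom.id ℂ) (x := (r j : ℂ)) (h.eval_eq_zero j)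
  exact this

end IsPrincipalRootList

theorem natDegree_polyInTau_of_ne_zero (h : tauLeadingCoeff L ≠ 0) :
    (polyInTau L ξ).natDegree = L.totalDegree :=
  Polynomial.natDegree_eq_of_le_of_coeff_ne_zero (natDegree_polyInTau_le le_rfl ξ)
    (by rwa [coeff_polyInTau le_rfl ξ])

theorem leadingCoeff_polyInTau (h : tauLeadingCoeff L ≠ 0) :
    (polyInTau L ξ).leadingCoeff = tauLeadingCoeff L := by
  rw [Polynomial.leadingCoeff, natDegree_polyInTau_of_ne_zero h, coeff_polyInTau le_rfl ξ]; rfl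

end PrincipalRoots

theorem MvPolynomial.IsHomogeneous.eval_mul_left {σ R : Type*} [Fintype σ] [CommSemiring R] {m : ℕ}
    {p : MvPolynomial σ R} (hp : p.IsHomogeneous m) (c : R) (x : σ → R) :
    MvPolynomial.eval (fun i => c * x i) p = c ^ m * MvPolynomial.eval x p := by
  rw [MvPolynomial.eval_eq', MvPolynomial.eval_eq', Finset.mul_sum]
  refine Finset.sum_congr rfl fun d hd => ?_
  have hdeg : ∑ i, d i = m := by
    rw [← Finsupp.degree_eq_sum, Finsupp.degree_eq_weight_one]
    exact hp (MvPolynomial.mem_support_iff.1 hd)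
  simp only [mul_pow, Finset.prod_mul_distrib, Finset.prod_pow_eq_pow_sum, hdeg]
  ring

/-- Splitting `L` into its homogeneous parts. -/
theorem eval_polyInTau_smul {n : ℕ} (L : MvPolynomial (Option (Fin n)) ℂ)
    (ξ : EuclideanSpace ℝ (Fin n)) (ρ : ℝ) (z : ℂ) :
    (polyInTau L (ρ • ξ)).eval (ρ * z) = ∑ k ∈ Finset.range (L.totalDegree + 1),
      (ρ : ℂ) ^ k * (polyInTau (MvPolynomial.homogeneousComponent k L) ξ).eval z := by
  have harg : (fun o : Option (Fin n) => o.elim ((ρ : ℂ) * z) (fun i => (((ρ • ξ) i : ℝ) : ℂ))) =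
      fun o => (ρ : ℂ) * o.elim z (fun i => ((ξ i : ℝ) : ℂ)) := by
    funext o
    cases o <;> simp
  rw [eval_polyInTau, harg]
  conv_lhs => rw [← MvPolynomial.sum_homogeneousComponent L, map_sum]
  refine Finset.sum_congr rfl fun k _ => ?_
  rw [eval_polyInTau]
  exact (MvPolynomial.homogeneousComponent_isHomogeneous k L).eval_mul_left _ _

/-! ### Smoothness and existence of the principal roots -/

theorem ContDiff.mvPolynomial_eval {σ G : Type*} [NormedAddCommGroup G] [NormedSpace ℝ G]
    {k : ℕ∞ω} (P : MvPolynomial σ ℂ) {g : G → σ → ℂ} (hg : ∀ i, ContDiff ℝ k fun v => g v i) :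
    ContDiff ℝ k fun v => MvPolynomial.eval (g v) P := by
  induction P using MvPolynomial.induction_on with
  | C a => simpa using contDiff_const
  | add p q hp hq => simpa using hp.add hq
  | mul_X p i hp => simpa using hp.mul (hg i)

theorem contDiff_eval_polyInTau {n : ℕ} (P : MvPolynomial (Option (Fin n)) ℂ) :
    ContDiff ℝ ∞ fun v : EuclideanSpace ℝ (Fin n) × ℂ => (polyInTau P v.1).eval v.2 := by
  simp only [eval_polyInTau]
  refine ContDiff.mvPolynomial_eval P fun o => ?_
  cases o with
  | none => exact contDiff_snd
  | some i =>
    exact Complex.ofRealCLM.contDiff.comp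
      ((EuclideanSpace.proj (𝕜 := ℝ) i).contDiff.comp contDiff_fst)

/-- The implicit function theorem at a simple root. -/
theorem exists_contDiffAt_root {n : ℕ} (P : MvPolynomial (Option (Fin n)) ℂ)
    {x₀ : EuclideanSpace ℝ (Fin n)} {z₀ : ℂ} (h0 : (polyInTau P x₀).eval z₀ = 0)
    (h1 : (polyInTau P x₀).derivative.eval z₀ ≠ 0) :
    ∃ g : EuclideanSpace ℝ (Fin n) → ℂ, ContDiffAt ℝ ∞ g x₀ ∧ g x₀ = z₀ ∧
      (∀ᶠ x in 𝓝 x₀, (polyInTau P x).eval (g x) = 0) ∧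
      ∀ᶠ v in 𝓝 (x₀, z₀), (polyInTau P v.1).eval v.2 = 0 → v.2 = g v.1 := by
  set f : EuclideanSpace ℝ (Fin n) × ℂ → ℂ := fun v => (polyInTau P v.1).eval v.2 with hf
  have hcd : ContDiffAt ℝ ∞ f (x₀, z₀) := (contDiff_eval_polyInTau P).contDiffAt
  have hne : (∞ : ℕ∞ω) ≠ 0 := by simp
  have hinv : (fderiv ℝ f (x₀, z₀) ∘L .inr ℝ (EuclideanSpace ℝ (Fin n)) ℂ).IsInvertible := by
    set w := (polyInTau P x₀).derivative.eval z₀ with hw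
    have hd1 : HasFDerivAt (fun z => f (x₀, z))
        (fderiv ℝ f (x₀, z₀) ∘L .inr ℝ (EuclideanSpace ℝ (Fin n)) ℂ) z₀ :=
      ((hcd.differentiableAt hne).hasFDerivAt (x := (x₀, z₀))).comp z₀
        (hasFDerivAt_prodMk_right x₀ z₀)
    have hd2 := ((polyInTau P x₀).hasDerivAt z₀).hasFDerivAt.restrictScalars ℝ
    -- The partial derivative in `z` is multiplication by `w ≠ 0`.
    rw [hd1.unique hd2]
    refine ContinuousLinearMap.IsInvertible.of_inverse
      (g := ContinuousLinearMap.mul ℝ ℂ w⁻¹) ?_ ?_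
    · ext; simp [← hw, mul_comm _ w, mul_inv_cancel_left₀ h1]
    · ext; simp [← hw, mul_comm _ w, inv_mul_cancel_left₀ h1]
  have hfu : f (x₀, z₀) = 0 := h0
  refine ⟨hcd.implicitFunction hne hinv, hcd.contDiffAt_implicitFunction hne hinv,
    hcd.implicitFunction_apply_self hne hinv, ?_, ?_⟩
  · filter_upwards [hcd.eventually_apply_implicitFunction hne hinv] with x hx
    exact hx.trans hfu
  · filter_upwards [hcd.eventually_apply_eq_iff_implicitFunction hne hinv] with v hv hv0
    exact (hv.1 (Eq.trans hv0 hfu.symm)).symm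

theorem contMDiffAt_sphere_of_contDiffAt {n : ℕ} {F : Type*} [NormedAddCommGroup F] [NormedSpace ℝ F]
    {g : EuclideanSpace ℝ (Fin (n + 1)) → F} {η : USphere (n + 1)}
    (hg : ContDiffAt ℝ ∞ g (η : EuclideanSpace ℝ (Fin (n + 1)))) :
    ContMDiffAt (𝓡 n) 𝓘(ℝ, F) ∞ (fun η : USphere (n + 1) => g η) η :=
  haveI : Fact (Module.finrank ℝ (EuclideanSpace ℝ (Fin (n + 1))) = n + 1) :=
    ⟨finrank_euclideanSpace_fin⟩
  ContMDiffAt.comp (g := g) η hg.contMDiffAt (contMDiff_coe_sphere η)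

theorem sphere_coe_ne_zero {n : ℕ} (η : USphere n) : (η : EuclideanSpace ℝ (Fin n)) ≠ 0 :=
  ne_zero_of_mem_unit_sphere η

namespace IsPrincipalRootFamily

/-- Continuous principal roots are smooth: near each point they agree with the function given by
the implicit function theorem. -/
theorem contMDiff {n : ℕ} {L : MvPolynomial (Option (Fin (n + 1))) ℂ}
    {φ : Fin L.totalDegree → USphere (n + 1) → ℝ} (hφ : IsPrincipalRootFamily L φ)
    (j : Fin L.totalDegree) : ContMDiff (𝓡 n) 𝓘(ℝ, ℝ) ∞ (φ j) := by
  intro η₀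
  obtain ⟨g, hg, -, -, hloc⟩ := exists_contDiffAt_root (principalPart L)
    ((hφ.2 η₀).eval_eq_zero j) ((hφ.2 η₀).eval_derivative_ne_zero j)
  have hre : ContDiffAt ℝ ∞ (fun x => (g x).re) (η₀ : EuclideanSpace ℝ (Fin (n + 1))) :=
    Complex.reCLM.contDiff.contDiffAt.comp _ hg
  refine (contMDiffAt_sphere_of_contDiffAt hre).congr_of_eventuallyEq ?_
  have hcont : Filter.Tendsto (fun η : USphere (n + 1) =>
      ((η : EuclideanSpace ℝ (Fin (n + 1))), (φ j η : ℂ))) (𝓝 η₀) (𝓝 (↑η₀, (φ j η₀ : ℂ))) :=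
    (continuous_subtype_val.prodMk
      (Complex.continuous_ofReal.comp (hφ.1 j))).tendsto η₀
  filter_upwards [hcont.eventually hloc] with η hη
  have := hη ((hφ.2 η).eval_eq_zero j)
  change φ j η = (g η).re
  rw [← this, Complex.ofReal_re]

end IsPrincipalRootFamily

/-- There is only one increasing list of `m` roots of the principal part. -/
theorem IsPrincipalRootList.eq_of_strictMono {n : ℕ} {L : MvPolynomial (Option (Fin n)) ℂ}
    {ξ : EuclideanSpace ℝ (Fin n)} {r s : Fin L.totalDegree → ℝ}
    (hr : IsPrincipalRootList L ξ r) (hrm : StrictMono r) (hsm : StrictMono s)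
    (hs : ∀ j, (polyInTau (principalPart L) ξ).eval (s j : ℂ) = 0) : s = r := by
  have hsub : Set.range s ⊆ Set.range r := by
    rintro _ ⟨j, rfl⟩
    obtain ⟨i, hi⟩ := (hr.2 _).1 (hs j)
    exact ⟨i, (Complex.ofReal_injective hi).symm⟩
  have hcard : (Finset.univ.image s) = (Finset.univ.image r) := by
    apply Finset.eq_of_subset_of_card_le
    · intro x hx
      simpa using hsub (by simpa using hx)
    · rw [Finset.card_image_of_injective _ hrm.injective,
        Finset.card_image_of_injective _ hsm.injective]
  refine (StrictMono.range_inj hsm hrm).1 ?_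
  have := congrArg (fun t : Finset ℝ => (t : Set ℝ)) hcard
  simpa using this

theorem IsPrincipalRootList.exists_strictMono {n : ℕ} {L : MvPolynomial (Option (Fin n)) ℂ}
    {ξ : EuclideanSpace ℝ (Fin n)} {r : Fin L.totalDegree → ℝ}
    (hr : IsPrincipalRootList L ξ r) :
    ∃ s, IsPrincipalRootList L ξ s ∧ StrictMono s := by
  refine ⟨r ∘ Tuple.sort r, ⟨hr.1.comp (Tuple.sort r).injective, fun z => ?_⟩,
    (Tuple.monotone_sort r).strictMono_of_injective (hr.1.comp (Tuple.sort r).injective)⟩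
  rw [hr.2]
  exact ((Tuple.sort r).surjective.exists (p := fun j => z = (r j : ℂ)))

/-- The principal roots listed in increasing order depend continuously on the point of the
sphere. -/
theorem IsStrictlyHyperbolic.exists_isPrincipalRootFamily {n : ℕ}
    {L : MvPolynomial (Option (Fin n)) ℂ} (hL : IsStrictlyHyperbolic L) :
    ∃ φ : Fin L.totalDegree → USphere n → ℝ, IsPrincipalRootFamily L φ := by
  have hex : ∀ η : USphere n, ∃ s, IsPrincipalRootList L (η : EuclideanSpace ℝ (Fin n)) s ∧
      StrictMono s := fun η => by
    obtain ⟨r, hr⟩ := hL η (sphere_coe_ne_zero η)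
    exact hr.exists_strictMono
  choose s hs hsm using hex
  refine ⟨fun j η => s η j, fun j => ?_, hs⟩
  rw [continuous_iff_continuousAt]
  intro η₀
  have hloc : ∀ i, ∃ g : USphere n → ℝ, ContinuousAt g η₀ ∧ g η₀ = s η₀ i ∧
      ∀ᶠ η : USphere n in 𝓝 η₀, (polyInTau (principalPart L) (η : EuclideanSpace ℝ (Fin n))).eval
        (g η : ℂ) = 0 := by
    intro i
    -- The root `g η` is real because all roots of the principal part at `η` are.
    obtain ⟨g, hg, hg0, hroot, -⟩ := exists_contDiffAt_root (principalPart L)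
      ((hs η₀).eval_eq_zero i) ((hs η₀).eval_derivative_ne_zero i)
    refine ⟨fun η : USphere n => (g η).re, ?_, by simp [hg0], ?_⟩
    · have hre : ContinuousAt (fun x => (g x).re) (η₀ : EuclideanSpace ℝ (Fin n)) :=
        Complex.continuous_re.continuousAt.comp hg.continuousAt
      exact ContinuousAt.comp (g := fun x => (g x).re) hre continuous_subtype_val.continuousAt
    · filter_upwards [(continuous_subtype_val.tendsto η₀).eventually hroot] with η hη
      obtain ⟨k, hk⟩ := ((hs η).2 _).1 hη
      rw [hk, Complex.ofReal_re]
      exact (hs η).eval_eq_zero k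
  choose g hg hg0 hroot using hloc
  have hmono : ∀ᶠ η in 𝓝 η₀, StrictMono fun i => g i η := by
    have : ∀ᶠ η in 𝓝 η₀, ∀ i k, i < k → g i η < g k η := by
      simp only [Filter.eventually_all]
      intro i k hik
      refine (hg i).eventually_lt (hg k) ?_
      rw [hg0, hg0]
      exact hsm η₀ hik
    filter_upwards [this] with η hη i k hik using hη i k hik
  refine (hg j).congr ?_
  filter_upwards [hmono, Filter.eventually_all.2 hroot] with η h1 h2
  exact congrFun ((hs η).eq_of_strictMono (hsm η) h1 h2) j

/-! ### Smooth algebraic functions on the sphere -/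

/-- Restriction of polynomials to the sphere. -/
noncomputable def sphereRestrict (n : ℕ) : MvPolynomial (Fin n) ℂ →+* (USphere n → ℂ) :=
  RingHom.pi fun η => realEval (η : EuclideanSpace ℝ (Fin n))

theorem sphereRestrict_apply {n : ℕ} (p : MvPolynomial (Fin n) ℂ) (η : USphere n) :
    sphereRestrict n p η = realEval (η : EuclideanSpace ℝ (Fin n)) p := rfl

theorem contMDiff_sphereRestrict {n : ℕ} (p : MvPolynomial (Fin (n + 1)) ℂ) :
    ContMDiff (𝓡 n) 𝓘(ℝ, ℂ) ∞ (sphereRestrict (n + 1) p) := by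
  intro η
  have : ContDiff ℝ ∞ (fun x : EuclideanSpace ℝ (Fin (n + 1)) => realEval x p) :=
    ContDiff.mvPolynomial_eval p fun i =>
      Complex.ofRealCLM.contDiff.comp (EuclideanSpace.proj (𝕜 := ℝ) i).contDiff
  exact contMDiffAt_sphere_of_contDiffAt this.contDiffAt

/-- The functions `f` on the sphere such that `D f` is integral over the polynomial functions for
some polynomial `D` without zeros on the sphere. -/
def almostIntegralFun (n : ℕ) : Subring (USphere n → ℂ) where
  carrier := {f | ∃ D : MvPolynomial (Fin n) ℂ, (∀ η, sphereRestrict n D η ≠ 0) ∧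
    (sphereRestrict n).IsIntegralElem (sphereRestrict n D * f)}
  mul_mem' := by
    rintro f g ⟨D, hD, hf⟩ ⟨E, hE, hg⟩
    refine ⟨D * E, fun η => ?_, ?_⟩
    · rw [map_mul]; exact mul_ne_zero (hD η) (hE η)
    · rw [map_mul, mul_mul_mul_comm]; exact hf.mul _ hg
  one_mem' := ⟨1, fun η => by simp, by simpa using (sphereRestrict n).isIntegralElem_one⟩
  add_mem' := by
    rintro f g ⟨D, hD, hf⟩ ⟨E, hE, hg⟩
    refine ⟨D * E, fun η => ?_, ?_⟩
    · rw [map_mul]; exact mul_ne_zero (hD η) (hE η)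
    · rw [map_mul, show sphereRestrict n D * sphereRestrict n E * (f + g) =
        sphereRestrict n E * (sphereRestrict n D * f) +
          sphereRestrict n D * (sphereRestrict n E * g) by ring]
      exact ((RingHom.isIntegralElem_map _).mul _ hf).add _
        ((RingHom.isIntegralElem_map _).mul _ hg)
  zero_mem' := ⟨1, fun η => by simp, by simpa using (sphereRestrict n).isIntegralElem_zero⟩
  neg_mem' := by
    rintro f ⟨D, hD, hf⟩
    exact ⟨D, hD, by rw [mul_neg]; exact hf.neg _⟩

theorem sphereRestrict_mem_almostIntegralFun {n : ℕ} (p : MvPolynomial (Fin n) ℂ) :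
    sphereRestrict n p ∈ almostIntegralFun n :=
  ⟨1, fun η => by simp, by simpa using RingHom.isIntegralElem_map _⟩

theorem isAlgebraicOnSphere_of_mem {n : ℕ} {f : USphere n → ℂ} (hf : f ∈ almostIntegralFun n) :
    IsAlgebraicOnSphere f := by
  obtain ⟨D, hD, P, hP, hroot⟩ := hf
  -- If `P` is monic with `P(D f) = 0`, then `P(D T)` vanishes at `f`, and it is nonzero wherever
  -- `D` is.
  refine ⟨P.comp (Polynomial.C D * Polynomial.X), fun η => ?_⟩
  rw [Polynomial.map_comp, Polynomial.map_mul, Polynomial.map_C, Polynomial.map_X]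
  refine ⟨?_, ?_⟩
  · refine fun h => (hP.map (realEval (η : EuclideanSpace ℝ (Fin n)))).ne_zero ?_
    exact (Polynomial.comp_C_mul_X_eq_zero_iff (mem_nonZeroDivisors_of_ne_zero (hD η))).1 h
  · have := congrFun hroot η
    rw [Polynomial.eval_comp, Polynomial.eval_map]
    have h2 := Polynomial.hom_eval₂ P (sphereRestrict n)
      (Pi.evalRingHom (fun _ : USphere n => ℂ) η) (sphereRestrict n D * f)
    rw [hroot, map_zero] at h2
    rw [Polynomial.eval_mul, Polynomial.eval_C, Polynomial.eval_X]
    exact h2.symm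

/-- The smooth functions in `almostIntegralFun`. -/
def smoothAlgFun (n : ℕ) : Subring (USphere (n + 1) → ℂ) where
  carrier := {f | ContMDiff (𝓡 n) 𝓘(ℝ, ℂ) ∞ f ∧ f ∈ almostIntegralFun (n + 1)}
  mul_mem' := fun hf hg => ⟨contDiff_mul.contMDiff.comp (hf.1.prodMk_space hg.1),
    mul_mem hf.2 hg.2⟩
  one_mem' := ⟨contMDiff_const, one_mem _⟩
  add_mem' := fun hf hg => ⟨hf.1.add hg.1, add_mem hf.2 hg.2⟩
  zero_mem' := ⟨contMDiff_const, zero_mem _⟩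
  neg_mem' := fun hf => ⟨hf.1.neg, neg_mem hf.2⟩

/-- Restriction of polynomials to the sphere, as smooth algebraic functions. -/
noncomputable def polyFun (n : ℕ) : MvPolynomial (Fin (n + 1)) ℂ →+* smoothAlgFun n :=
  (sphereRestrict (n + 1)).codRestrict (smoothAlgFun n) fun p =>
    ⟨contMDiff_sphereRestrict p, sphereRestrict_mem_almostIntegralFun p⟩

/-- Evaluation of a smooth algebraic function at a point of the sphere. -/
def evalFun {n : ℕ} (η : USphere (n + 1)) : smoothAlgFun n →+* ℂ :=
  (Pi.evalRingHom (fun _ => ℂ) η).comp (smoothAlgFun n).subtype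

theorem evalFun_apply {n : ℕ} (η : USphere (n + 1)) (f : smoothAlgFun n) :
    evalFun η f = (f : USphere (n + 1) → ℂ) η := rfl

theorem evalFun_comp_polyFun {n : ℕ} (η : USphere (n + 1)) :
    (evalFun η).comp (polyFun n) = realEval (η : EuclideanSpace ℝ (Fin (n + 1))) := rfl

theorem smoothAlgFun_ext {n : ℕ} {f g : smoothAlgFun n} (h : ∀ η, evalFun η f = evalFun η g) :
    f = g :=
  Subtype.ext (funext h)

theorem exists_norm_evalFun_le {n : ℕ} (f : smoothAlgFun n) :
    ∃ B, ∀ η, ‖evalFun η f‖ ≤ B := by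
  have hc : Continuous (f : USphere (n + 1) → ℂ) := f.2.1.continuous
  obtain ⟨B, hB⟩ := isCompact_univ.exists_bound_of_continuousOn hc.continuousOn
  exact ⟨B, fun η => hB η (Set.mem_univ η)⟩

/-- Polynomials in `ε` with smooth coefficients are bounded for `0 ≤ ε ≤ 1`, uniformly on the
sphere. -/
theorem exists_norm_eval₂_evalFun_le {n : ℕ} (H : Polynomial (smoothAlgFun n)) :
    ∃ B : ℝ, 0 ≤ B ∧ ∀ η, ∀ ε : ℝ, 0 ≤ ε → ε ≤ 1 → ‖H.eval₂ (evalFun η) (ε : ℂ)‖ ≤ B := by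
  choose b hb using fun k => exists_norm_evalFun_le (H.coeff k)
  refine ⟨∑ k ∈ Finset.range (H.natDegree + 1), |b k|,
    Finset.sum_nonneg fun _ _ => abs_nonneg _, fun η ε h0 h1 => ?_⟩
  rw [Polynomial.eval₂_eq_sum_range]
  refine norm_sum_le_of_le _ fun k _ => ?_
  rw [norm_mul, norm_pow, Complex.norm_real, Real.norm_of_nonneg h0]
  calc _ ≤ |b k| * 1 := by
        gcongr
        · exact (hb k η).trans (le_abs_self _)
        · exact pow_le_one₀ h0 h1
    _ = _ := mul_one _

namespace IsPrincipalRootFamily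

variable {n : ℕ} {L : MvPolynomial (Option (Fin (n + 1))) ℂ}
  {φ : Fin L.totalDegree → USphere (n + 1) → ℝ}

/-- The principal root `φ j` is integral over the polynomials, the principal part being monic in `τ`
up to the constant `tauLeadingCoeff L`. -/
theorem mem_smoothAlgFun (hφ : IsPrincipalRootFamily L φ) (j : Fin L.totalDegree) :
    (fun η => (φ j η : ℂ)) ∈ smoothAlgFun n := by
  refine ⟨Complex.ofRealCLM.contDiff.contMDiff.comp (hφ.contMDiff j), ?_⟩
  have hc := (hφ.2 ⟨EuclideanSpace.single 0 1, by simp⟩).tauLeadingCoeff_ne_zero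
  set f := MvPolynomial.optionEquivLeft ℂ (Fin (n + 1)) (principalPart L) with hf
  have hdeg := natDegree_optionEquivLeft_le_of_totalDegree_le (totalDegree_principalPart_le L)
  have hcoeff := coeff_optionEquivLeft_of_totalDegree_le (totalDegree_principalPart_le L)
  rw [coeff_principalPart] at hcoeff
  refine ⟨1, fun η => by simp, Polynomial.C (MvPolynomial.C (tauLeadingCoeff L)⁻¹) * f, ?_, ?_⟩
  · refine Polynomial.monic_of_natDegree_le_of_coeff_eq_one L.totalDegree
      ((Polynomial.natDegree_C_mul_le _ _).trans hdeg) ?_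
    rw [Polynomial.coeff_C_mul, hcoeff, ← MvPolynomial.C_mul, inv_mul_cancel₀ hc,
      MvPolynomial.C_1]
  · rw [Polynomial.eval₂_mul]
    convert mul_zero _
    ext η
    have h := (hφ.2 η).eval_eq_zero j
    rw [polyInTau_eq_map, Polynomial.eval_map] at h
    have h2 := Polynomial.hom_eval₂ f (sphereRestrict (n + 1))
      (Pi.evalRingHom (fun _ : USphere (n + 1) => ℂ) η)
      (sphereRestrict (n + 1) 1 * fun η => (φ j η : ℂ))
    refine h2.trans ?_
    rw [map_one, one_mul]
    exact h

/-- The principal root `φ j` as an element of `smoothAlgFun`. -/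
def rootFun (hφ : IsPrincipalRootFamily L φ) (j : Fin L.totalDegree) : smoothAlgFun n :=
  ⟨_, hφ.mem_smoothAlgFun j⟩

theorem evalFun_eval (hφ : IsPrincipalRootFamily L φ) (j : Fin L.totalDegree)
    (f : Polynomial (MvPolynomial (Fin (n + 1)) ℂ)) (η : USphere (n + 1)) :
    evalFun η ((f.map (polyFun n)).eval (hφ.rootFun j)) =
      (f.map (realEval (η : EuclideanSpace ℝ (Fin (n + 1))))).eval (φ j η : ℂ) := by
  rw [Polynomial.eval_map, Polynomial.hom_eval₂, evalFun_comp_polyFun, Polynomial.eval_map]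
  rfl

theorem eval_rootFun (hφ : IsPrincipalRootFamily L φ) (j : Fin L.totalDegree) :
    ((MvPolynomial.optionEquivLeft ℂ (Fin (n + 1)) (principalPart L)).map (polyFun n)).eval
      (hφ.rootFun j) = 0 := by
  refine smoothAlgFun_ext fun η => ?_
  rw [hφ.evalFun_eval, ← polyInTau_eq_map, (hφ.2 η).eval_eq_zero, map_zero]

/-- The resultant `D` of the principal part `f` and `f'` is a polynomial in `η` that has no zeros
on the sphere. Since `D = f p + f' q`, it follows that `1 / f'(φ j) = q(φ j) / D`. -/
theorem exists_mul_derivative_eq_one (hφ : IsPrincipalRootFamily L φ) (j : Fin L.totalDegree) :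
    ∃ u : smoothAlgFun n,
      u * ((MvPolynomial.optionEquivLeft ℂ (Fin (n + 1)) (principalPart L)).map
        (polyFun n)).derivative.eval (hφ.rootFun j) = 1 := by
  set f := MvPolynomial.optionEquivLeft ℂ (Fin (n + 1)) (principalPart L) with hf
  have hdeg := natDegree_optionEquivLeft_le_of_totalDegree_le (totalDegree_principalPart_le L)
  obtain ⟨p, q, -, -, hpq⟩ := Polynomial.exists_mul_add_mul_eq_C_resultant f f.derivative hdeg
    ((Polynomial.natDegree_derivative_le f).trans (Nat.sub_le_sub_right hdeg 1))
    (Or.inl (Fin.pos j).ne')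
  set D := Polynomial.resultant f f.derivative L.totalDegree (L.totalDegree - 1) with hD
  have hD0 : ∀ η, sphereRestrict (n + 1) D η ≠ 0 := by
    intro η
    have hsep := (hφ.2 η).separable
    have hnd := (hφ.2 η).natDegree_eq
    rw [sphereRestrict_apply, hD, ← Polynomial.resultant_map_map, ← Polynomial.derivative_map,
      ← polyInTau_eq_map, ← hnd, ← Polynomial.natDegree_derivative]
    exact Polynomial.resultant_ne_zero _ _ hsep
  have hrel : (f.derivative.map (polyFun n)).eval (hφ.rootFun j) *
      (q.map (polyFun n)).eval (hφ.rootFun j) = polyFun n D := by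
    have := congrArg (fun g => (g.map (polyFun n)).eval (hφ.rootFun j)) hpq
    simpa only [Polynomial.map_add, Polynomial.map_mul, Polynomial.eval_add, Polynomial.eval_mul,
      hφ.eval_rootFun, hf, zero_mul, zero_add, Polynomial.map_C, Polynomial.eval_C] using this
  have hinv : (sphereRestrict (n + 1) D)⁻¹ ∈ smoothAlgFun n := by
    refine ⟨?_, D, hD0, ?_⟩
    · intro η
      exact ((contDiffAt_inv ℝ (hD0 η)).contMDiffAt).comp η (contMDiff_sphereRestrict D η)
    · convert (sphereRestrict (n + 1)).isIntegralElem_one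
      ext η
      exact mul_inv_cancel₀ (hD0 η)
  refine ⟨(q.map (polyFun n)).eval (hφ.rootFun j) * ⟨_, hinv⟩, ?_⟩
  rw [Polynomial.derivative_map, mul_right_comm, mul_comm _ (Polynomial.eval _ _), hrel]
  exact Subtype.ext (funext fun η => mul_inv_cancel₀ (hD0 η))

end IsPrincipalRootFamily

/-! ### The asymptotic expansion -/

/-- The polynomial `F(z, ε) = ∑ ε ^ (m - k) L_k(z, η)`, with smooth coefficients on the sphere, for
which `L(ρ z, ρ η) = ρ ^ m F(z, 1 / ρ)`. The outer variable is `z`, the inner one `ε`. -/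
noncomputable def rescaledSymbol {n : ℕ} (L : MvPolynomial (Option (Fin (n + 1))) ℂ) :
    Polynomial (Polynomial (smoothAlgFun n)) :=
  ∑ k ∈ Finset.range (L.totalDegree + 1), Polynomial.C (Polynomial.X ^ (L.totalDegree - k)) *
    ((MvPolynomial.optionEquivLeft ℂ (Fin (n + 1)) (MvPolynomial.homogeneousComponent k L)).map
      (polyFun n)).map Polynomial.C

theorem map_rescaledSymbol {n : ℕ} (L : MvPolynomial (Option (Fin (n + 1))) ℂ) :
    (rescaledSymbol L).map (Polynomial.evalRingHom 0) =
      (MvPolynomial.optionEquivLeft ℂ (Fin (n + 1)) (principalPart L)).map (polyFun n) := by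
  have hid : (Polynomial.evalRingHom (0 : smoothAlgFun n)).comp Polynomial.C = RingHom.id _ :=
    RingHom.ext fun x => by simp
  rw [rescaledSymbol, Polynomial.map_sum, Finset.sum_range_succ, Finset.sum_eq_zero, zero_add]
  · rw [Polynomial.map_mul, Polynomial.map_map Polynomial.C, hid, Polynomial.map_id]
    simp [principalPart]
  · intro k hk
    have : L.totalDegree - k ≠ 0 := by have := Finset.mem_range.1 hk; omega
    simp [this]

theorem eval_polyInTau_rescale {n : ℕ} (L : MvPolynomial (Option (Fin (n + 1))) ℂ)
    (η : USphere (n + 1)) {ρ : ℝ} (hρ : 0 < ρ) (S : Polynomial (smoothAlgFun n)) :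
    (polyInTau L (ρ • (η : EuclideanSpace ℝ (Fin (n + 1))))).eval
        (ρ * S.eval₂ (evalFun η) ((ρ⁻¹ : ℝ) : ℂ)) =
      (ρ : ℂ) ^ L.totalDegree *
        ((rescaledSymbol L).eval S).eval₂ (evalFun η) ((ρ⁻¹ : ℝ) : ℂ) := by
  have hρ' : (ρ : ℂ) ≠ 0 := by exact_mod_cast hρ.ne'
  set Φ := Polynomial.eval₂RingHom (evalFun η) ((ρ⁻¹ : ℝ) : ℂ) with hΦ
  have hcomp : (Φ.comp Polynomial.C).comp (polyFun n) =
      realEval (η : EuclideanSpace ℝ (Fin (n + 1))) := by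
    rw [← evalFun_comp_polyFun]
    congr 1
    ext1 x
    simp [hΦ]
  change Polynomial.eval (ρ * Φ S) _ = _ * Φ ((rescaledSymbol L).eval S)
  rw [eval_polyInTau_smul, rescaledSymbol, Polynomial.eval_finsetSum, map_sum, Finset.mul_sum]
  refine Finset.sum_congr rfl fun k hk => ?_
  have hk' : k ≤ L.totalDegree := Nat.lt_succ_iff.1 (Finset.mem_range.1 hk)
  rw [Polynomial.eval_mul, Polynomial.eval_C, map_mul, map_pow, Polynomial.eval_map,
    Polynomial.hom_eval₂, Polynomial.eval₂_map, hcomp, polyInTau_eq_map, Polynomial.eval_map,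
    ← mul_assoc]
  congr 1
  have hX : Φ Polynomial.X = (ρ : ℂ)⁻¹ := by simp [hΦ]
  rw [hX, ← Nat.sub_add_cancel hk', pow_add, Nat.sub_add_cancel hk', mul_right_comm, ← mul_pow,
    mul_inv_cancel₀ hρ', one_pow, one_mul]

theorem le_div_mul_inv_pow_of_mul_le {a b B K ρ : ℝ} {m N : ℕ} (hρ : 0 < ρ) (hK : 0 < K)
    (hm : m ≠ 0) (hb : b ≤ B)
    (h : a * (ρ ^ (m - 1) * K) ≤ ρ ^ m * (ρ⁻¹ ^ (N + 1) * b)) :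
    a ≤ B / K * (ρ ^ N)⁻¹ := by
  obtain ⟨m, rfl⟩ := Nat.exists_eq_succ_of_ne_zero hm
  rw [Nat.succ_eq_add_one, Nat.add_sub_cancel] at h
  have hpow : ρ ^ (m + 1) * (ρ⁻¹ ^ (N + 1) * b) = ρ ^ m * (b * (ρ ^ N)⁻¹) := by
    rw [inv_pow]
    field_simp
    ring
  rw [hpow, mul_left_comm] at h
  have h' := le_of_mul_le_mul_left h (by positivity)
  rw [div_mul_eq_mul_div, le_div_iff₀ hK]
  exact h'.trans (by gcongr)

namespace IsPrincipalRootFamily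

variable {n : ℕ} {L : MvPolynomial (Option (Fin (n + 1))) ℂ}
  {φ : Fin L.totalDegree → USphere (n + 1) → ℝ}

/-- The formal expansion of a root of the rescaled symbol in powers of `ε`. -/
theorem exists_formal_root (hφ : IsPrincipalRootFamily L φ) (j : Fin L.totalDegree) :
    ∃ s : ℕ → smoothAlgFun n, s 0 = hφ.rootFun j ∧
      ∀ N, Polynomial.X ^ (N + 1) ∣ (rescaledSymbol L).eval
        (∑ k ∈ Finset.range (N + 1), Polynomial.C (s k) * Polynomial.X ^ k) := by
  obtain ⟨u, hu⟩ := hφ.exists_mul_derivative_eq_one j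
  refine Polynomial.exists_formal_root (rescaledSymbol L) (hφ.rootFun j) u ?_ ?_
  · rw [map_rescaledSymbol, hφ.eval_rootFun]
  · rw [map_rescaledSymbol, hu]

/-- The principal roots are uniformly separated, by compactness of the sphere. -/
theorem exists_separation (hφ : IsPrincipalRootFamily L φ) :
    ∃ δ : ℝ, 0 < δ ∧ ∀ η, ∀ i j, i ≠ j → δ ≤ ‖(φ i η : ℂ) - (φ j η : ℂ)‖ := by
  have hpair : ∀ i j, ∀ᶠ δ : ℝ in 𝓝[>] 0, i ≠ j → ∀ η, δ ≤ ‖(φ i η : ℂ) - (φ j η : ℂ)‖ := by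
    intro i j
    by_cases hij : i = j
    · exact Filter.Eventually.of_forall fun _ h => absurd hij h
    obtain ⟨B, hB0, hB⟩ : ∃ B : ℝ, 0 < B ∧ ∀ η, B ≤ ‖(φ i η : ℂ) - (φ j η : ℂ)‖ := by
      have hcont : Continuous fun η => ‖(φ i η : ℂ) - (φ j η : ℂ)‖ :=
        ((Complex.continuous_ofReal.comp (hφ.1 i)).sub
          (Complex.continuous_ofReal.comp (hφ.1 j))).norm
      obtain ⟨B, hB0, hB⟩ := isCompact_univ.exists_forall_le' (a := 0) hcont.continuousOn
        (fun η _ => norm_pos_iff.2 (sub_ne_zero.2 fun h =>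
          hij ((hφ.2 η).1 (Complex.ofReal_injective h))))
      exact ⟨B, hB0, fun η => hB η (Set.mem_univ η)⟩
    filter_upwards [Ioo_mem_nhdsGT hB0] with δ hδ _ η
    exact hδ.2.le.trans (hB η)
  have hall : ∀ᶠ δ : ℝ in 𝓝[>] 0, 0 < δ ∧
      ∀ i j, i ≠ j → ∀ η, δ ≤ ‖(φ i η : ℂ) - (φ j η : ℂ)‖ := by
    refine Filter.Eventually.and self_mem_nhdsWithin ?_
    simp only [Filter.eventually_all] at hpair ⊢
    exact hpair
  obtain ⟨δ, hδ, h⟩ := hall.exists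
  exact ⟨δ, hδ, fun η i j hij => h i j hij η⟩

/-- The characteristic roots can be labelled so that, for large `ρ`, the `j`-th one at `ρ η` is
close to `ρ φ j η`. -/
theorem exists_characteristicRootFamily (hφ : IsPrincipalRootFamily L φ)
    (hc : tauLeadingCoeff L ≠ 0) {δ : ℝ} (hδ : 0 < δ)
    (hsep : ∀ η, ∀ i j, i ≠ j → δ ≤ ‖(φ i η : ℂ) - (φ j η : ℂ)‖) :
    ∃ τ : Fin L.totalDegree → EuclideanSpace ℝ (Fin (n + 1)) → ℂ,
      IsCharacteristicRootFamily L τ ∧ ∃ R : ℝ, ∀ ρ : ℝ, R ≤ ρ → ∀ η : USphere (n + 1),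
        ∀ j, ‖τ j (ρ • (η : EuclideanSpace ℝ (Fin (n + 1)))) - ρ * (φ j η : ℂ)‖
          < (ρ * δ) / 4 := by
  -- The truncation of the formal root to its constant term `φ j`.
  have hbound : ∀ j, ∃ B : ℝ, 0 ≤ B ∧ ∀ η : USphere (n + 1), ∀ ρ : ℝ, 1 ≤ ρ →
      ‖(polyInTau L (ρ • (η : EuclideanSpace ℝ (Fin (n + 1))))).eval (ρ * (φ j η : ℂ))‖ ≤
        ρ ^ L.totalDegree * (ρ⁻¹ * B) := by
    intro j
    obtain ⟨s, hs0, hs⟩ := hφ.exists_formal_root j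
    obtain ⟨H, hH⟩ := hs 0
    obtain ⟨B, hB0, hB⟩ := exists_norm_eval₂_evalFun_le H
    refine ⟨B, hB0, fun η ρ hρ => ?_⟩
    have hρ0 : 0 < ρ := by linarith
    have h := eval_polyInTau_rescale L η hρ0
      (∑ k ∈ Finset.range (0 + 1), Polynomial.C (s k) * Polynomial.X ^ k)
    have hval : (∑ k ∈ Finset.range (0 + 1), Polynomial.C (s k) * Polynomial.X ^ k).eval₂
        (evalFun η) ((ρ⁻¹ : ℝ) : ℂ) = (φ j η : ℂ) := by
      simp [hs0]; rfl
    rw [hval] at h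
    rw [h, hH, Polynomial.eval₂_mul, zero_add, pow_one, Polynomial.eval₂_X, norm_mul, norm_mul,
      norm_pow, Complex.norm_real, Complex.norm_real, Real.norm_of_nonneg hρ0.le,
      Real.norm_of_nonneg (inv_nonneg.2 hρ0.le)]
    gcongr
    exact hB η _ (inv_nonneg.2 hρ0.le) (inv_le_one_of_one_le₀ hρ)
  choose B hB0 hB using hbound
  set K : ℝ := ‖tauLeadingCoeff L‖ * (δ / 4) ^ L.totalDegree with hK
  have hK0 : 0 < K := by positivity
  -- For `ρ ≥ R` the values at `ρ φ j` are so small that `Polynomial.exists_roots_near` applies.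
  set R : ℝ := 1 + ∑ j, B j / K with hR
  have hBR : ∀ j, B j / K < R := by
    intro j
    have := Finset.single_le_sum (f := fun j => B j / K)
      (fun i _ => div_nonneg (hB0 i) hK0.le) (Finset.mem_univ j)
    linarith
  have hR1 : 1 ≤ R := by
    have := Finset.sum_nonneg (s := Finset.univ) (f := fun j => B j / K)
      (fun i _ => div_nonneg (hB0 i) hK0.le)
    linarith
  have hpt : ∀ ξ : EuclideanSpace ℝ (Fin (n + 1)), ∃ z : Fin L.totalDegree → ℂ,
      (polyInTau L ξ).roots = (Finset.univ : Finset (Fin L.totalDegree)).val.map z ∧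
      ∀ (ρ : ℝ) (η : USphere (n + 1)), R ≤ ρ → ξ = ρ • (η : EuclideanSpace ℝ (Fin (n + 1))) →
        ∀ j, ‖z j - ρ * (φ j η : ℂ)‖ < (ρ * δ) / 4 := by
    intro ξ
    by_cases hξ : ∃ (ρ : ℝ) (η : USphere (n + 1)), R ≤ ρ ∧
        ξ = ρ • (η : EuclideanSpace ℝ (Fin (n + 1)))
    swap
    · obtain ⟨z, hz⟩ := Polynomial.exists_roots_eq_map
        (natDegree_polyInTau_of_ne_zero (ξ := ξ) hc)
      exact ⟨z, hz, fun ρ η h1 h2 => (hξ ⟨ρ, η, h1, h2⟩).elim⟩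
    obtain ⟨ρ, η, hρ, rfl⟩ := hξ
    have hρ0 : 0 < ρ := by linarith
    obtain ⟨z, hz, hnear⟩ := Polynomial.exists_roots_near
      (natDegree_polyInTau_of_ne_zero (ξ := ρ • (η : EuclideanSpace ℝ (Fin (n + 1)))) hc)
      (Polynomial.leadingCoeff_ne_zero.1 (by rwa [leadingCoeff_polyInTau hc]))
      (w := fun j => ρ * (φ j η : ℂ)) (δ := ρ * δ)
      (fun i j hij => by
        rw [← mul_sub, norm_mul, Complex.norm_real, Real.norm_of_nonneg hρ0.le]
        exact mul_le_mul_of_nonneg_left (hsep η i j hij) hρ0.le)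
      (by positivity)
      (fun j => by
        refine (hB j η ρ (hR1.trans hρ)).trans_lt ?_
        rw [leadingCoeff_polyInTau hc, mul_div_assoc, mul_pow,
          mul_left_comm ‖tauLeadingCoeff L‖, ← hK]
        have h1 : B j < ρ * K := (div_lt_iff₀ hK0).1 ((hBR j).trans_le hρ)
        have h2 : ρ⁻¹ * B j < K := by
          rwa [inv_mul_lt_iff₀ hρ0]
        gcongr)
    refine ⟨z, hz, fun ρ' η' hρ' heq j => ?_⟩
    have hρ'0 : 0 < ρ' := by linarith
    have hρeq : ρ = ρ' := by
      have := congrArg norm heq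
      rwa [norm_smul, norm_smul, norm_eq_of_mem_sphere, norm_eq_of_mem_sphere, mul_one, mul_one,
        Real.norm_of_nonneg hρ0.le, Real.norm_of_nonneg hρ'0.le] at this
    subst hρeq
    have hηeq : η = η' := Subtype.ext (smul_right_injective _ hρ0.ne' heq)
    subst hηeq
    exact hnear j
  choose z hz hnear using hpt
  exact ⟨fun j ξ => z ξ j, hz, R, fun ρ hρ η j => hnear _ ρ η hρ rfl j⟩

/-- Characteristic roots close to `ρ φ j` have the asymptotic expansion given by the formal
root. -/
theorem hasUniformExpansion (hφ : IsPrincipalRootFamily L φ)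
    (hc : tauLeadingCoeff L ≠ 0) {δ : ℝ} (hδ : 0 < δ)
    (hsep : ∀ η, ∀ i j, i ≠ j → δ ≤ ‖(φ i η : ℂ) - (φ j η : ℂ)‖)
    {τ : Fin L.totalDegree → EuclideanSpace ℝ (Fin (n + 1)) → ℂ}
    (hτ : IsCharacteristicRootFamily L τ) {R : ℝ}
    (hnear : ∀ ρ : ℝ, R ≤ ρ → ∀ η : USphere (n + 1),
        ∀ j, ‖τ j (ρ • (η : EuclideanSpace ℝ (Fin (n + 1)))) - ρ * (φ j η : ℂ)‖
          < (ρ * δ) / 4)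
    (j : Fin L.totalDegree) {s : ℕ → smoothAlgFun n} (hs0 : s 0 = hφ.rootFun j)
    (hs : ∀ N, Polynomial.X ^ (N + 1) ∣ (rescaledSymbol L).eval
        (∑ k ∈ Finset.range (N + 1), Polynomial.C (s k) * Polynomial.X ^ k)) :
    HasUniformExpansion (τ j) (φ j) (fun k => (s (k + 1) : USphere (n + 1) → ℂ)) := by
  intro N
  obtain ⟨H, hH⟩ := hs N
  obtain ⟨B, hB0, hB⟩ := exists_norm_eval₂_evalFun_le H
  obtain ⟨B', hB'0, hB'⟩ := exists_norm_eval₂_evalFun_le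
    (∑ k ∈ Finset.range N, Polynomial.C (s (k + 1)) * Polynomial.X ^ k)
  set K : ℝ := ‖tauLeadingCoeff L‖ * (δ / 2) ^ (L.totalDegree - 1) with hK
  have hK0 : 0 < K := by positivity
  refine ⟨B / K, max (max R 1) (4 * B' / δ), by positivity, fun ρ hρ η => ?_⟩
  have hρR : R ≤ ρ := (le_max_left _ _).trans ((le_max_left _ _).trans hρ)
  have hρ1 : 1 ≤ ρ := (le_max_right _ _).trans ((le_max_left _ _).trans hρ)
  have hρB : 4 * B' / δ ≤ ρ := (le_max_right _ _).trans hρ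
  have hρ0 : 0 < ρ := by linarith
  have hρC : (ρ : ℂ) ≠ 0 := by exact_mod_cast hρ0.ne'
  have hε0 : 0 ≤ ρ⁻¹ := inv_nonneg.2 hρ0.le
  have hε1 : ρ⁻¹ ≤ 1 := inv_le_one_of_one_le₀ hρ1
  set S := ∑ k ∈ Finset.range (N + 1), Polynomial.C (s k) * Polynomial.X ^ k with hS
  set T := ∑ k ∈ Finset.range N, Polynomial.C (s (k + 1)) * Polynomial.X ^ k with hT
  have hTval : T.eval₂ (evalFun η) ((ρ⁻¹ : ℝ) : ℂ) =
      ∑ k ∈ Finset.range N, ((ρ : ℂ) ^ k)⁻¹ * (s (k + 1) : USphere (n + 1) → ℂ) η := by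
    rw [hT, Polynomial.eval₂_finsetSum]
    refine Finset.sum_congr rfl fun k _ => ?_
    rw [Polynomial.eval₂_mul, Polynomial.eval₂_C, Polynomial.eval₂_X_pow, evalFun_apply, mul_comm,
      Complex.ofReal_inv, inv_pow]
  have hST : S = Polynomial.C (hφ.rootFun j) + Polynomial.X * T := by
    rw [hS, Finset.sum_range_succ', hs0, hT, Finset.mul_sum, pow_zero, mul_one,
      add_comm (Polynomial.C _)]
    congr 1
    exact Finset.sum_congr rfl fun k _ => by ring
  have hSval : ρ * S.eval₂ (evalFun η) ((ρ⁻¹ : ℝ) : ℂ) =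
      ρ * (φ j η : ℂ) + T.eval₂ (evalFun η) ((ρ⁻¹ : ℝ) : ℂ) := by
    rw [hST, Polynomial.eval₂_add, Polynomial.eval₂_C, Polynomial.eval₂_mul, Polynomial.eval₂_X,
      mul_add, Complex.ofReal_inv, mul_inv_cancel_left₀ hρC]
    rfl
  -- The bound `4 B' / δ ≤ ρ` keeps the truncation within a quarter of the separation.
  have hclose : ‖ρ * S.eval₂ (evalFun η) ((ρ⁻¹ : ℝ) : ℂ) - ρ * (φ j η : ℂ)‖ ≤ (ρ * δ) / 4 := by
    rw [hSval, add_sub_cancel_left]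
    refine (hB' η _ hε0 hε1).trans ?_
    have := (div_le_iff₀ hδ).1 hρB
    linarith
  have hmain := Polynomial.norm_sub_root_mul_le (w := fun i => ρ * (φ i η : ℂ)) (δ := ρ * δ)
    (by positivity) (hτ (ρ • (η : EuclideanSpace ℝ (Fin (n + 1)))))
    (fun i k hik => by
      rw [← mul_sub, norm_mul, Complex.norm_real, Real.norm_of_nonneg hρ0.le]
      exact mul_le_mul_of_nonneg_left (hsep η i k hik) hρ0.le)
    (hnear ρ hρR η) j hclose
  rw [eval_polyInTau_rescale L η hρ0, hH, Polynomial.eval₂_mul, Polynomial.eval₂_X_pow, norm_mul,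
    norm_mul, norm_pow, norm_pow, Complex.norm_real, Complex.norm_real,
    Real.norm_of_nonneg hρ0.le, Real.norm_of_nonneg hε0, leadingCoeff_polyInTau hc, mul_div_assoc,
    mul_pow, mul_left_comm ‖tauLeadingCoeff L‖, ← hK, hSval, hTval, norm_sub_rev] at hmain
  exact le_div_mul_inv_pow_of_mul_le hρ0 hK0 (Fin.pos j).ne' (hB η _ hε0 hε1) hmain

end IsPrincipalRootFamily

theorem mainTheorem5 (n : ℕ) (L : MvPolynomial (Option (Fin (n + 1))) ℂ)
    (hL : IsStrictlyHyperbolic L) :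
    (∃ φ : Fin L.totalDegree → USphere (n + 1) → ℝ, IsPrincipalRootFamily L φ) ∧
    ∀ φ : Fin L.totalDegree → USphere (n + 1) → ℝ, IsPrincipalRootFamily L φ →
      (∀ j, ContMDiff (𝓡 n) 𝓘(ℝ, ℝ) ∞ (φ j)) ∧
      ∃ τ : Fin L.totalDegree → EuclideanSpace ℝ (Fin (n + 1)) → ℂ,
        IsCharacteristicRootFamily L τ ∧
        ∃ t : Fin L.totalDegree → ℕ → USphere (n + 1) → ℂ,
          (∀ j k, ContMDiff (𝓡 n) 𝓘(ℝ, ℂ) ∞ (t j k)) ∧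
          (∀ j k, IsAlgebraicOnSphere (t j k)) ∧
          ∀ j, HasUniformExpansion (τ j) (φ j) (t j) := by
  refine ⟨hL.exists_isPrincipalRootFamily, fun φ hφ => ⟨hφ.contMDiff, ?_⟩⟩
  have hc : tauLeadingCoeff L ≠ 0 := by
    have h1 : EuclideanSpace.single (0 : Fin (n + 1)) (1 : ℝ) ≠ 0 := by simp
    obtain ⟨r, hr⟩ := hL _ h1
    exact hr.tauLeadingCoeff_ne_zero
  obtain ⟨δ, hδ, hsep⟩ := hφ.exists_separation
  obtain ⟨τ, hτ, R, hnear⟩ := hφ.exists_characteristicRootFamily hc hδ hsep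
  choose s hs0 hs using hφ.exists_formal_root
  exact ⟨τ, hτ, fun j k => s j (k + 1), fun j k => (s j (k + 1)).2.1,
    fun j k => isAlgebraicOnSphere_of_mem (s j (k + 1)).2.2,
    fun j => hφ.hasUniformExpansion hc hδ hsep hτ hnear j (hs0 j) (hs j)⟩
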